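/- Let $V$ be a countable set, $\hat\Sigma$ a simplicial complex on $V$ (a family of finite subsets of $V$ closed under passing to subsets, so that $\varnothing\in\hat\Sigma$ if $\hat\Sigma$ is nonempty), and $m:\hat\Sigma\to(0,\infty)$ a weight. Let $\Sigma=\hat\Sigma$ if the total weight $\sum_{\{v\}\in\hat\Sigma}m(\{v\})$ of the vertices is finite, and $\Sigma=\hat\Sigma\setminus\{\varnothing\}$ otherwise. For $\tau,\sigma\in\Sigma$ write $\tau\prec\sigma$ if $\tau\subset\sigma$ and $|\sigma\setminus\tau|=1$, and assume that $m$ is locally summable: $\sum_{\sigma\succ\tau}m(\sigma)<\infty$ for all $\tau\in\Sigma$. Let $\delta:\mathbb R^\Sigma\to\mathbb R^\Sigma$ be a coboundary operator, i.e. a linear map with $\delta\delta=0$ of the form $\delta\omega(\sigma)=\sum_{\tau\prec\sigma}\omega(\tau)\theta(\tau,\sigma)$, where $\theta(\tau,\sigma)=\delta 1_\tau(\sigma)\in\{-1,0,1\}$, and $\theta(\tau,\sigma)\neq0$ if and only if $\tau\prec\sigma$. On $F^1=\{\omega\in\mathbb R^\Sigma: \sum_{\sigma\succ\tau}m(\sigma)|\omega(\sigma)|<\infty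 \text{ for all }\tau\in\Sigma\}$ let $\partial\omega(\rho)=\frac1{m(\rho)}\sum_{\tau\succ\rho}m(\tau)\omega(\tau)\theta(\rho,\tau)$. In the real Hilbert space $\ell^2=\ell^2(\Sigma,m)$, with norm $\|\omega\|^2=\sum_{\Sigma}m\,\omega^2$, put $T^+=\delta$ (on $\mathbb R^\Sigma$), $T^-=\partial$ and $T^H=\delta+\partial$ (both on $F^1$). For $\bullet\in\{+,-,H\}$ let $Q^\bullet_N$ be the closed form $Q_N^\bullet(\omega)=\|T^\bullet\omega\|^2$ with domain $\{\omega\in\ell^2: T^\bullet\omega \text{ is defined and lies in }\ell^2\}$, and let $Q^\bullet_D$ be its restriction to the closure of the finitely supported functions with respect to the norm $(Q^\bullet_N(\cdot)+\|\cdot\|^2)^{1/2}$. Let $\Delta^\bullet_N$ and $\Delta^\bullet_D$ be the positive self-adjoint operators on $\ell^2$ associated with $Q^\bullet_N$ and $Q^\bullet_D$. If $Q^H_D=Q^H_N$, then $\Delta^\bullet_D=\Delta^\bullet_N=:\Delta^\bullet$ for each $\bullet\in\{+,-,H\}$, and the spectra satisfy $$\sigma(\Delta^+)\setminus\{0\}=\sigma(\Delta^H)\setminus\{0\}=\sigma(\Delta^-)\setminus\{0\}.$$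 -/

import Mathlib

noncomputable section

open MeasureTheory Filter Topology

namespace SimplicialLaplacian

/-! ### Forms and unbounded operators on a real Hilbert space -/

section Abstract

variable {H : Type*} [NormedAddCommGroup H] [InnerProductSpace ℝ H]

/-- A positive symmetric quadratic form on a subspace of `H`, given by its polarization. -/
structure QForm (H : Type*) [NormedAddCommGroup H] [InnerProductSpace ℝ H] where
  /-- the form domain `D(Q)` -/
  domain : Submodule ℝ H
  /-- the bilinear form `Q(x, y)` -/
  form : LinearMap.BilinForm ℝ domain
  symm : ∀ x y, form x y = form y x
  nonneg : ∀ x, 0 ≤ form x x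

/-- The form `x ↦ ‖T x‖²` on the domain of an operator `T`. -/
def QForm.ofOperator (T : H →ₗ.[ℝ] H) : QForm H where
  domain := T.domain
  form := (innerₗ H).compl₁₂ T.toFun T.toFun
  symm _ _ := real_inner_comm _ _
  nonneg _ := real_inner_self_nonneg

theorem QForm.form_add_le (Q : QForm H) (x y : Q.domain) :
    Q.form (x + y) (x + y) ≤ 2 * Q.form x x + 2 * Q.form y y := by
  have h := Q.nonneg (x - y)
  simp only [map_add, map_sub, LinearMap.add_apply, LinearMap.sub_apply] at h ⊢
  linarith

theorem QForm.form_smul (Q : QForm H) (c : ℝ) (x : Q.domain) :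
    Q.form (c • x) (c • x) = c ^ 2 * Q.form x x := by
  simp only [map_smul, LinearMap.smul_apply, smul_eq_mul]
  ring

/-- The square `Q(x) + ‖x‖²` of the form norm. -/
def QForm.normSq (Q : QForm H) (x : Q.domain) : ℝ := Q.form x x + ‖(x : H)‖ ^ 2

theorem QForm.normSq_nonneg (Q : QForm H) (x : Q.domain) : 0 ≤ Q.normSq x :=
  add_nonneg (Q.nonneg x) (sq_nonneg _)

theorem QForm.normSq_add_le (Q : QForm H) (x y : Q.domain) :
    Q.normSq (x + y) ≤ 2 * Q.normSq x + 2 * Q.normSq y := by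
  have h1 := Q.form_add_le x y
  have h2 : ‖((x + y : Q.domain) : H)‖ ^ 2 ≤ 2 * ‖(x : H)‖ ^ 2 + 2 * ‖(y : H)‖ ^ 2 := by
    have h3 : ‖((x + y : Q.domain) : H)‖ ≤ ‖(x : H)‖ + ‖(y : H)‖ := norm_add_le _ _
    nlinarith [norm_nonneg ((x + y : Q.domain) : H), sq_nonneg (‖(x : H)‖ - ‖(y : H)‖)]
  unfold QForm.normSq
  linarith

theorem QForm.normSq_smul (Q : QForm H) (c : ℝ) (x : Q.domain) :
    Q.normSq (c • x) = c ^ 2 * Q.normSq x := by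
  unfold QForm.normSq
  rw [Q.form_smul, Submodule.coe_smul, norm_smul, mul_pow, Real.norm_eq_abs, sq_abs]
  ring

/-- The closure, within `D(Q)` and for the form norm, of the subspace `S ∩ D(Q)`. -/
def QForm.closureDomain (Q : QForm H) (S : Submodule ℝ H) : Submodule ℝ Q.domain where
  carrier := {x | ∃ u : ℕ → Q.domain, (∀ n, (u n : H) ∈ S) ∧
    Tendsto (fun n => Q.normSq (x - u n)) atTop (𝓝 0)}
  zero_mem' := ⟨fun _ => 0, fun _ => S.zero_mem, by simp [QForm.normSq]⟩
  add_mem' := by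
    rintro x y ⟨u, hu, hu'⟩ ⟨v, hv, hv'⟩
    refine ⟨fun n => u n + v n, fun n => S.add_mem (hu n) (hv n), ?_⟩
    have hlim : Tendsto (fun n => 2 * Q.normSq (x - u n) + 2 * Q.normSq (y - v n))
        atTop (𝓝 0) := by
      simpa using (hu'.const_mul 2).add (hv'.const_mul 2)
    refine squeeze_zero (fun n => Q.normSq_nonneg _) (fun n => ?_) hlim
    have := Q.normSq_add_le (x - u n) (y - v n)
    rwa [show x - u n + (y - v n) = x + y - (u n + v n) by abel] at this
  smul_mem' := by
    rintro c x ⟨u, hu, hu'⟩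
    refine ⟨fun n => c • u n, fun n => S.smul_mem c (hu n), ?_⟩
    have hlim := hu'.const_mul (c ^ 2)
    rw [mul_zero] at hlim
    refine hlim.congr fun n => ?_
    rw [← smul_sub, Q.normSq_smul]

/-- The restriction of `Q` to the form-norm closure of `S ∩ D(Q)`. -/
def QForm.closureRestrict (Q : QForm H) (S : Submodule ℝ H) : QForm H where
  domain := (Q.closureDomain S).map Q.domain.subtype
  form := Q.form.compl₁₂
    (Submodule.inclusion (Submodule.map_subtype_le Q.domain (Q.closureDomain S)))
    (Submodule.inclusion (Submodule.map_subtype_le Q.domain (Q.closureDomain S)))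
  symm _ _ := Q.symm _ _
  nonneg _ := Q.nonneg _

/-- The graph of the operator associated with `Q`: the pairs `(y, z)` with `y ∈ D(Q)` and
`Q(x, y) = ⟨x, z⟩` for all `x ∈ D(Q)`. -/
def QForm.operatorGraph (Q : QForm H) : Submodule ℝ (H × H) where
  carrier := {p | ∃ h : p.1 ∈ Q.domain, ∀ x : Q.domain, Q.form x ⟨p.1, h⟩ = inner ℝ (x : H) p.2}
  zero_mem' := ⟨Q.domain.zero_mem, fun x => by
    have : (⟨(0 : H × H).1, Q.domain.zero_mem⟩ : Q.domain) = 0 := rfl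
    rw [this]; simp⟩
  add_mem' := by
    rintro p q ⟨hp, hp'⟩ ⟨hq, hq'⟩
    refine ⟨Q.domain.add_mem hp hq, fun x => ?_⟩
    have : (⟨(p + q).1, Q.domain.add_mem hp hq⟩ : Q.domain) = ⟨p.1, hp⟩ + ⟨q.1, hq⟩ := rfl
    rw [this, map_add, hp', hq', Prod.snd_add, inner_add_right]
  smul_mem' := by
    rintro c p ⟨hp, hp'⟩
    refine ⟨Q.domain.smul_mem c hp, fun x => ?_⟩
    have : (⟨(c • p).1, Q.domain.smul_mem c hp⟩ : Q.domain) = c • ⟨p.1, hp⟩ := rfl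
    rw [this, map_smul, hp', Prod.smul_snd, inner_smul_right, smul_eq_mul]

/-- The operator `Δ` associated with `Q`, i.e. `Q(x, y) = ⟨x, Δ y⟩` for `x ∈ D(Q)`, `y ∈ D(Δ)`,
with the largest possible domain `D(Δ) ⊆ D(Q)`; for a densely defined closed positive form it is
the unique self-adjoint operator with this property. (If `D(Q)` is dense, `operatorGraph` is the
graph of a function, and it is then the graph of this operator.) -/
def QForm.operator (Q : QForm H) : H →ₗ.[ℝ] H := Q.operatorGraph.toLinearPMap

theorem QForm.operator_graph (Q : QForm H) (hQ : Dense (Q.domain : Set H)) :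
    Q.operator.graph = Q.operatorGraph := by
  refine Submodule.toLinearPMap_graph_eq _ ?_
  rintro ⟨y, z⟩ ⟨hy, h⟩ (rfl : y = 0)
  have h0 : ∀ x ∈ Q.domain, inner ℝ x z = 0 := fun x hx => by
    rw [← h ⟨x, hx⟩]
    exact map_zero (Q.form ⟨x, hx⟩)
  exact hQ.eq_zero_of_inner_right ℝ (fun v hv => h0 v hv)

/-- The resolvent set of an unbounded operator: those `z` for which `A - z : D(A) → H` is a
bijection with bounded inverse `R`. -/
def opResolventSet (A : H →ₗ.[ℝ] H) : Set ℝ :=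
  {z | ∃ R : H →L[ℝ] H,
    (∀ y : H, ∃ h : R y ∈ A.domain, A ⟨R y, h⟩ - z • R y = y) ∧
    (∀ x : A.domain, R (A x - z • (x : H)) = x)}

/-- The spectrum of an unbounded operator. -/
def opSpectrum (A : H →ₗ.[ℝ] H) : Set ℝ := (opResolventSet A)ᶜ

end Abstract

/-! ### Weighted simplicial complexes -/

/-- A collection of finite subsets of `V` that is closed under passing to subsets (so that a
nonempty complex contains the empty set). -/
structure SComplex (V : Type*) where
  faces : Set (Finset V)
  down_closed : ∀ {σ τ : Finset V}, σ ∈ faces → τ ⊆ σ → τ ∈ faces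

/-- A strictly positive weight on a complex. -/
structure Weight {V : Type*} (K : SComplex V) where
  toFun : K.faces → ℝ
  pos : ∀ σ, 0 < toFun σ

variable {V : Type*} {K : SComplex V}

/-- The total weight of the vertices is finite. -/
def Weight.FiniteVertexMass (m : Weight K) : Prop :=
  Summable fun v : {σ : K.faces // σ.1.card = 1} => m.toFun v.1

/-- The set `Σ` of simplices: all elements of the complex, where the empty simplex is admitted
only if the total weight of the vertices is finite. -/
def Simplex (m : Weight K) : Type _ := {σ : K.faces // σ.1 = ∅ → m.FiniteVertexMass}

/-- The underlying finite set of vertices. -/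
def Simplex.verts {m : Weight K} (σ : Simplex m) : Finset V := σ.1.1

/-- The weight of a simplex. -/
def Simplex.wt {m : Weight K} (σ : Simplex m) : ℝ := m.toFun σ.1

/-- `τ ≺ σ`: `τ` is a face of `σ` (of codimension one), `σ` is a coface of `τ`. -/
def Simplex.IsFace {m : Weight K} (τ σ : Simplex m) : Prop :=
  τ.verts ⊆ σ.verts ∧ σ.verts.card = τ.verts.card + 1

/-- For every simplex the total weight of its cofaces is finite. -/
def Weight.LocallySummable (m : Weight K) : Prop :=
  ∀ τ : Simplex m, Summable fun σ : {σ : Simplex m // τ.IsFace σ} => σ.1.wt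

/-- The space `F` of all real functions on the simplices. -/
abbrev Fn (m : Weight K) : Type _ := Simplex m → ℝ

/-- The characteristic function of a simplex. -/
def char {m : Weight K} (τ : Simplex m) : Fn m := Set.indicator {τ} fun _ => 1

/-- Coboundary operators. -/
structure Coboundary (m : Weight K) where
  toLin : Fn m →ₗ[ℝ] Fn m
  char_mem : ∀ τ σ, toLin (char τ) σ ∈ ({-1, 0, 1} : Set ℝ)
  char_ne_zero : ∀ τ σ, toLin (char τ) σ ≠ 0 ↔ τ.IsFace σ
  /-- the value at `σ` is the signed sum over the finitely many faces of `σ` -/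
  apply_eq : ∀ ω σ, toLin ω σ = ∑ᶠ τ : {τ : Simplex m // τ.IsFace σ}, ω τ * toLin (char τ.1) σ
  sq_zero : ∀ ω, toLin (toLin ω) = 0

variable {m : Weight K}

/-- The incidence sign `θ(τ, σ)`. -/
def Coboundary.sign (δ : Coboundary m) (τ σ : Simplex m) : ℝ := δ.toLin (char τ) σ

theorem Coboundary.abs_sign_le (δ : Coboundary m) (τ σ : Simplex m) : |δ.sign τ σ| ≤ 1 := by
  have h := δ.char_mem τ σ
  simp only [Set.mem_insert_iff, Set.mem_singleton_iff] at h
  rcases h with h | h | h <;> simp [Coboundary.sign, h]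

/-- The space `F¹` of functions `ω` with `∑_{σ ≻ τ} m(σ) |ω(σ)| < ∞` for all `τ`. -/
def F1 (m : Weight K) : Submodule ℝ (Fn m) where
  carrier := {ω | ∀ τ : Simplex m,
    Summable fun σ : {σ : Simplex m // τ.IsFace σ} => σ.1.wt * |ω σ|}
  zero_mem' := fun τ => by simp
  add_mem' := by
    intro ω η hω hη τ
    refine Summable.of_nonneg_of_le
      (fun σ => mul_nonneg (m.pos _).le (abs_nonneg _)) (fun σ => ?_) ((hω τ).add (hη τ))
    rw [← mul_add]
    exact mul_le_mul_of_nonneg_left (abs_add_le _ _) (m.pos _).le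
  smul_mem' := by
    intro c ω hω τ
    refine ((hω τ).mul_left |c|).congr fun σ => ?_
    simp only [Pi.smul_apply, smul_eq_mul, abs_mul]
    ring

theorem Coboundary.summable_boundary (δ : Coboundary m) {ω : Fn m} (hω : ω ∈ F1 m)
    (ρ : Simplex m) :
    Summable fun τ : {τ : Simplex m // ρ.IsFace τ} => τ.1.wt * ω τ * δ.sign ρ τ := by
  refine Summable.of_norm_bounded (hω ρ) fun τ => ?_
  have hw : |τ.1.wt| = τ.1.wt := abs_of_pos (m.pos _)
  rw [Real.norm_eq_abs, abs_mul, abs_mul, hw]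
  exact mul_le_of_le_one_right (mul_nonneg (m.pos _).le (abs_nonneg _)) (δ.abs_sign_le _ _)

/-- The boundary operator `∂`, with domain `F¹`. -/
def Coboundary.boundary (δ : Coboundary m) : Fn m →ₗ.[ℝ] Fn m where
  domain := F1 m
  toFun :=
    { toFun := fun ω ρ =>
        1 / ρ.wt * ∑' τ : {τ : Simplex m // ρ.IsFace τ}, τ.1.wt * ω.1 τ * δ.sign ρ τ
      map_add' := by
        intro ω η
        funext ρ
        have h := (δ.summable_boundary ω.2 ρ).tsum_add (δ.summable_boundary η.2 ρ)
        rw [Pi.add_apply, ← mul_add, ← h]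
        refine congrArg (1 / ρ.wt * ·) (tsum_congr fun τ => ?_)
        simp only [Submodule.coe_add, Pi.add_apply]
        ring
      map_smul' := by
        intro c ω
        funext ρ
        rw [RingHom.id_apply, Pi.smul_apply, smul_eq_mul, mul_left_comm, ← tsum_mul_left (a := c)]
        refine congrArg (1 / ρ.wt * ·) (tsum_congr fun τ => ?_)
        simp only [Submodule.coe_smul, Pi.smul_apply, smul_eq_mul]
        ring }

/-- The three types of energies and Laplacians: `+`, `-` and `H`. -/
inductive Kind
  | up
  | down
  | hodge

/-- The operators `δ` (on `F`), `∂` (on `F¹`) and `δ + ∂` (on `F¹`) on functions. -/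
def Coboundary.op (δ : Coboundary m) : Kind → (Fn m →ₗ.[ℝ] Fn m)
  | .up => δ.toLin.toPMap ⊤
  | .down => δ.boundary
  | .hodge => δ.toLin.toPMap ⊤ + δ.boundary

/-! ### The Hilbert space `ℓ²(Σ, m)` -/

instance : MeasurableSpace (Simplex m) := ⊤

instance : DiscreteMeasurableSpace (Simplex m) := ⟨fun _ => trivial⟩

/-- The weight as a measure on the set of simplices. -/
def Weight.measure (m : Weight K) : Measure (Simplex m) :=
  Measure.sum fun σ => ENNReal.ofReal σ.wt • Measure.dirac σ

theorem eq_of_ae_eq {f g : Fn m} (h : f =ᵐ[m.measure] g) : f = g := by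
  funext σ
  by_contra hne
  have h0 : m.measure {x | f x ≠ g x} = 0 := h
  rw [Weight.measure, Measure.sum_apply _ (MeasurableSet.of_discrete),
    ENNReal.tsum_eq_zero] at h0
  have h1 := h0 σ
  rw [Measure.smul_apply, Measure.dirac_apply' _ MeasurableSet.of_discrete,
    Set.indicator_of_mem (show σ ∈ {x | f x ≠ g x} from hne)] at h1
  simp only [Pi.one_apply, smul_eq_mul, mul_one, ENNReal.ofReal_eq_zero] at h1
  exact absurd (m.pos σ.1) (not_lt.mpr h1)

/-- The Hilbert space `ℓ²(Σ, m)` of functions with `∑ m |ω|² < ∞`. -/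
abbrev L2 (m : Weight K) : Type _ := Lp ℝ 2 m.measure

/-- An element of `ℓ²(Σ, m)` as a function (every simplex has positive measure). -/
def L2.fn (m : Weight K) : L2 m →ₗ[ℝ] Fn m where
  toFun f := f
  map_add' f g := eq_of_ae_eq (Lp.coeFn_add f g)
  map_smul' c f := eq_of_ae_eq (Lp.coeFn_smul c f)

/-- The maximal realization in `ℓ²` of an operator `T` on functions: its domain consists of the
`ω ∈ ℓ² ∩ D(T)` with `T ω ∈ ℓ²`. -/
def maxRealization (T : Fn m →ₗ.[ℝ] Fn m) : L2 m →ₗ.[ℝ] L2 m where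
  domain :=
    { carrier := {f | ∃ h : L2.fn m f ∈ T.domain, MemLp (T ⟨L2.fn m f, h⟩) 2 m.measure}
      zero_mem' := by
        have h : L2.fn m 0 ∈ T.domain := by rw [map_zero]; exact T.domain.zero_mem
        refine ⟨h, ?_⟩
        rw [show (⟨L2.fn m 0, h⟩ : T.domain) = 0 from Subtype.ext (map_zero _), T.map_zero]
        exact MemLp.zero
      add_mem' := by
        rintro f g ⟨hf, hf'⟩ ⟨hg, hg'⟩
        have h : L2.fn m (f + g) ∈ T.domain := by rw [map_add]; exact T.domain.add_mem hf hg
        refine ⟨h, ?_⟩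
        rw [show (⟨L2.fn m (f + g), h⟩ : T.domain) = ⟨L2.fn m f, hf⟩ + ⟨L2.fn m g, hg⟩ from
          Subtype.ext (map_add _ _ _), T.map_add]
        exact hf'.add hg'
      smul_mem' := by
        rintro c f ⟨hf, hf'⟩
        have h : L2.fn m (c • f) ∈ T.domain := by rw [map_smul]; exact T.domain.smul_mem c hf
        refine ⟨h, ?_⟩
        rw [show (⟨L2.fn m (c • f), h⟩ : T.domain) = c • ⟨L2.fn m f, hf⟩ from
          Subtype.ext (map_smul _ _ _), T.map_smul]
        exact hf'.const_smul c }
  toFun :=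
    { toFun := fun f => MemLp.toLp (T ⟨L2.fn m f.1, f.2.1⟩) f.2.2
      map_add' := by
        rintro ⟨f, hf, hf'⟩ ⟨g, hg, hg'⟩
        rw [← MemLp.toLp_add]
        refine MemLp.toLp_congr _ _ (Eventually.of_forall fun σ => ?_)
        rw [← T.map_add]
        exact congrFun (congrArg T (Subtype.ext (map_add (L2.fn m) f g))) σ
      map_smul' := by
        rintro c ⟨f, hf, hf'⟩
        rw [RingHom.id_apply, ← MemLp.toLp_const_smul]
        refine MemLp.toLp_congr _ _ (Eventually.of_forall fun σ => ?_)
        rw [← T.map_smul]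
        exact congrFun (congrArg T (Subtype.ext (map_smul (L2.fn m) c f))) σ }

/-- The space `F^c` of finitely supported functions, as a subspace of `ℓ²`. -/
def finSupp (m : Weight K) : Submodule ℝ (L2 m) where
  carrier := {f | (Function.support (L2.fn m f)).Finite}
  zero_mem' := by simp
  add_mem' := by
    intro f g hf hg
    simp only [Set.mem_ofPred_eq, map_add] at hf hg ⊢
    exact (hf.union hg).subset (Function.support_add _ _)
  smul_mem' := by
    intro c f hf
    simp only [Set.mem_ofPred_eq, map_smul] at hf ⊢
    exact hf.subset (Function.support_const_smul_subset _ _)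

/-! ### Dirichlet and Neumann forms and Laplacians -/

/-- The Neumann form `ω ↦ ‖T ω‖²`, `T = δ, ∂, δ + ∂`, on all `ω ∈ ℓ² ∩ D(T)` with `T ω ∈ ℓ²`. -/
def Coboundary.formN (δ : Coboundary m) (k : Kind) : QForm (L2 m) :=
  QForm.ofOperator (maxRealization (δ.op k))

/-- The Dirichlet form: the restriction of the Neumann form to the form-norm closure of the
finitely supported functions. -/
def Coboundary.formD (δ : Coboundary m) (k : Kind) : QForm (L2 m) :=
  (δ.formN k).closureRestrict (finSupp m)

/-- The Laplacians with Neumann boundary conditions. -/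
def Coboundary.laplacianN (δ : Coboundary m) (k : Kind) : L2 m →ₗ.[ℝ] L2 m :=
  (δ.formN k).operator

/-- The Laplacians with Dirichlet boundary conditions. -/
def Coboundary.laplacianD (δ : Coboundary m) (k : Kind) : L2 m →ₗ.[ℝ] L2 m :=
  (δ.formD k).operator

end SimplicialLaplacian

end

/-! Let `d`, `e`, `t` be the maximal realizations of `δ`, `∂`, `δ + ∂` in `ℓ²`. By Green's formula
each is determined by testing against the functions `1_τ`: `d` is the adjoint of `∂` on finitely
supported functions, `e` that of `δ`, and `t` that of `δ + ∂`. The form norm is the graph norm, so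
equality of the Dirichlet and Neumann forms says that the finitely supported functions are a core of
the operator.

Assume this for `t`. Since `δδ = 0`, the range of `d` is orthogonal to that of the closure of `∂` on
finitely supported functions. Hence convergence of `δω + ∂ω` forces convergence of both summands,
and `t` splits as `d` plus this closure (`exists_add_of_mem_closure_span_add`). If `(x, y)` in the
graph of `d` is orthogonal to all `(1_τ, δ1_τ)`, then `e y = -x` and `d y = 0`, so `y` lies in the
domain of `t`. The splitting puts `(y, -x)` in the closure of `∂`, and pairing it with `(x, y)`
gives `-‖x‖² = ‖y‖²`. So `d` has the core, and then so does `e` (`graph_le_closure_span`).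

Consequently `d` and `e` are mutually adjoint, `t = d + e` is self-adjoint, and the Laplacians are
`ed`, `de` and `t² = ed + de`. Away from zero the spectra of `ed` and `de` agree
(`IsRegularAt.relComp_swap`), and `dd = ee = 0` makes `t²` regular exactly when its two summands are
(`IsRegularAt.of_sum`, `IsRegularAt.sum`). Operators are handled through their graphs, as linear
relations, so that domains are carried along automatically. -/

noncomputable section

open MeasureTheory Filter Topology

namespace SimplicialLaplacian

/-! ### Linear relations: compositions, regular points, adjoints -/

section LinearRelations

variable {H : Type*} [NormedAddCommGroup H] [InnerProductSpace ℝ H]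

/-- `G'` is the adjoint of the linear relation `G`. -/
def IsAdjointRel (G G' : Submodule ℝ (H × H)) : Prop :=
  ∀ x y, (x, y) ∈ G' ↔ ∀ p ∈ G, inner ℝ p.2 x = inner ℝ p.1 y

/-- The composition "first `G`, then `G'`" of linear relations. -/
def relComp (G G' : Submodule ℝ (H × H)) : Submodule ℝ (H × H) where
  carrier := {p | ∃ u, (p.1, u) ∈ G ∧ (u, p.2) ∈ G'}
  zero_mem' := ⟨0, G.zero_mem, G'.zero_mem⟩
  add_mem' := by
    rintro p q ⟨u, hu, hu'⟩ ⟨v, hv, hv'⟩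
    exact ⟨u + v, G.add_mem hu hv, G'.add_mem hu' hv'⟩
  smul_mem' := by
    rintro c p ⟨u, hu, hu'⟩
    exact ⟨c • u, G.smul_mem c hu, G'.smul_mem c hu'⟩

theorem mem_relComp {G G' : Submodule ℝ (H × H)} {x w : H} :
    (x, w) ∈ relComp G G' ↔ ∃ u, (x, u) ∈ G ∧ (u, w) ∈ G' := Iff.rfl

/-- `A - z` is a bijection from the domain of the linear relation `A` onto `H`. -/
def IsRegularAt (A : Submodule ℝ (H × H)) (z : ℝ) : Prop :=
  (∀ y, ∃ x, (x, y + z • x) ∈ A) ∧ ∀ x, (x, z • x) ∈ A → x = 0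

theorem mem_of_mem_of_eq {G : Submodule ℝ (H × H)} {x u x' u' : H} (h : (x, u) ∈ G)
    (hx : x = x') (hu : u = u') : (x', u') ∈ G := hx ▸ hu ▸ h

/-- Since `G` kills its own range, `a + b` lies in the domain of `G` exactly when `b` does, and
likewise for `G'` and `a`. So the square of the sum has no cross terms and no domain mismatch. -/
theorem relComp_sum_self {G G' T : Submodule ℝ (H × H)}
    (hT : ∀ x y, (x, y) ∈ T ↔ ∃ u v, (x, u) ∈ G ∧ (x, v) ∈ G' ∧ y = u + v)
    (hG : ∀ x y, (x, y) ∈ G → (y, 0) ∈ G) (hG' : ∀ x y, (x, y) ∈ G' → (y, 0) ∈ G') (x w : H) :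
    (x, w) ∈ relComp T T ↔ ∃ a b p q, (x, a) ∈ G ∧ (x, b) ∈ G' ∧ (a, p) ∈ G' ∧ (b, q) ∈ G ∧
      w = p + q := by
  rw [mem_relComp]
  constructor
  · rintro ⟨c, hc, hc'⟩
    obtain ⟨a, b, ha, hb, rfl⟩ := (hT _ _).1 hc
    obtain ⟨q, p, hq, hp, rfl⟩ := (hT _ _).1 hc'
    exact ⟨a, b, p, q, ha, hb,
      mem_of_mem_of_eq (G'.sub_mem hp (hG' _ _ hb)) (by simp) (by simp),
      mem_of_mem_of_eq (G.sub_mem hq (hG _ _ ha)) (by simp) (by simp), add_comm _ _⟩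
  · rintro ⟨a, b, p, q, ha, hb, hp, hq, rfl⟩
    exact ⟨a + b, (hT _ _).2 ⟨a, b, ha, hb, rfl⟩, (hT _ _).2 ⟨q, p,
      mem_of_mem_of_eq (G.add_mem (hG _ _ ha) hq) (by simp) (by simp),
      mem_of_mem_of_eq (G'.add_mem hp (hG' _ _ hb)) (by simp) (by simp), add_comm _ _⟩⟩

theorem IsRegularAt.of_sum {G G' C : Submodule ℝ (H × H)} {z : ℝ} (hz : z ≠ 0)
    (hC : ∀ x w, (x, w) ∈ C ↔ ∃ a b p q, (x, a) ∈ G ∧ (x, b) ∈ G' ∧ (a, p) ∈ G' ∧ (b, q) ∈ G ∧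
      w = p + q)
    (hG : ∀ x y, (x, y) ∈ G → (y, 0) ∈ G) (hG' : ∀ x y, (x, y) ∈ G' → (y, 0) ∈ G')
    (h : IsRegularAt C z) : IsRegularAt (relComp G G') z := by
  refine ⟨fun y => ?_, fun x hx => ?_⟩
  -- Subtracting `z⁻¹ q`, which `G` annihilates, leaves `a` unchanged and removes `q` from the
  -- equation `p + q = y + z x`.
  · obtain ⟨x, hx⟩ := h.1 y
    obtain ⟨a, b, p, q, ha, hb, hp, hq, he⟩ := (hC _ _).1 hx
    refine ⟨x - z⁻¹ • q, a,
      mem_of_mem_of_eq (G.sub_mem ha (G.smul_mem z⁻¹ (hG _ _ hq))) rfl (by simp),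
      mem_of_mem_of_eq hp rfl ?_⟩
    rw [smul_sub, smul_inv_smul₀ hz, ← add_sub_assoc, he, add_sub_cancel_right]
  -- An eigenvector of `G'G` with `z ≠ 0` lies in the range of `G'`, hence in its kernel, so it is
  -- an eigenvector of the sum.
  · obtain ⟨a, ha, ha'⟩ := hx
    have hx0 : (x, (0 : H)) ∈ G' :=
      mem_of_mem_of_eq (G'.smul_mem z⁻¹ (hG' _ _ ha')) (by simp [hz]) (by simp)
    exact h.2 x ((hC _ _).2 ⟨a, 0, z • x, 0, ha, hx0, ha', G.zero_mem, by simp⟩)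

theorem IsRegularAt.sum {G G' C : Submodule ℝ (H × H)} {z : ℝ} (hz : z ≠ 0)
    (hC : ∀ x w, (x, w) ∈ C ↔ ∃ a b p q, (x, a) ∈ G ∧ (x, b) ∈ G' ∧ (a, p) ∈ G' ∧ (b, q) ∈ G ∧
      w = p + q)
    (hG : ∀ x y, (x, y) ∈ G → (y, 0) ∈ G) (hG' : ∀ x y, (x, y) ∈ G' → (y, 0) ∈ G')
    (h : IsRegularAt (relComp G G') z) (h' : IsRegularAt (relComp G' G) z) :
    IsRegularAt C z := by
  refine ⟨fun y => ?_, fun x hx => ?_⟩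
  · obtain ⟨u, a, ha, hp⟩ := h.1 y
    obtain ⟨v, b, hb, hq⟩ := h'.1 y
    -- `v + z⁻¹ y` is in the range of `G` and `u + z⁻¹ y` in that of `G'`. Hence `G` sees only `u`,
    -- `G'` sees only `v`, and the image is `2y + z(u + v)`.
    refine ⟨u + v + z⁻¹ • y, (hC _ _).2 ⟨a, b, _, _, ?_, ?_, hp, hq, ?_⟩⟩
    · refine mem_of_mem_of_eq (G.add_mem ha (G.smul_mem z⁻¹ (hG _ _ hq))) ?_ (by simp)
      simp only [Prod.smul_fst, smul_add, inv_smul_smul₀ hz]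
      abel
    · refine mem_of_mem_of_eq (G'.add_mem hb (G'.smul_mem z⁻¹ (hG' _ _ hp))) ?_ (by simp)
      simp only [Prod.smul_fst, smul_add, inv_smul_smul₀ hz]
      abel
    · simp only [smul_add, smul_inv_smul₀ hz]
      abel
  · obtain ⟨a, b, p, q, ha, hb, hp, hq, he⟩ := (hC _ _).1 hx
    -- The component `p` of `z x = p + q` is itself an eigenvector of `G'G`, because `G` kills `q`;
    -- symmetrically for `q`.
    have hp0 : p = 0 := by
      refine h.2 p ⟨z • a, ?_, G'.smul_mem z hp⟩
      refine mem_of_mem_of_eq (G.sub_mem (G.smul_mem z ha) (hG _ _ hq)) ?_ (by simp)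
      simp [he]
    have hq0 : q = 0 := by
      refine h'.2 q ⟨z • b, ?_, G.smul_mem z hq⟩
      refine mem_of_mem_of_eq (G'.sub_mem (G'.smul_mem z hb) (hG' _ _ hp)) ?_ (by simp)
      simp [he]
    rw [hp0, hq0, add_zero] at he
    exact (smul_eq_zero.1 he).resolve_left hz

/-- The formal inverse `z⁻¹(G (G'G - z)⁻¹ G' - 1)` of `GG' - z` makes sense only on the domain of
`G'`. Replacing `y` by `w = (1 + GG')⁻¹ y`, which is in that domain, extends it to all of `H`. -/
theorem IsRegularAt.relComp_swap {G G' : Submodule ℝ (H × H)} {z : ℝ} (hz : z ≠ 0)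
    (hfun : ∀ y, ((0 : H), y) ∈ G → y = 0)
    (hsurj : ∀ y, ∃ w, (w, y - w) ∈ relComp G' G)
    (h : IsRegularAt (relComp G G') z) : IsRegularAt (relComp G' G) z := by
  refine ⟨fun y => ?_, fun x hx => ?_⟩
  · obtain ⟨w, v, hv, hw⟩ := hsurj y
    obtain ⟨u, a, ha, ha'⟩ := h.1 v
    have h1 : (a - w, z • u) ∈ G' := mem_of_mem_of_eq (G'.sub_mem ha' hv) rfl (by simp)
    -- From `y = (GG' - z)w + (z + 1)w`: the first term is solved by `w`, the second by the formal
    -- inverse at `w`, which is `z⁻¹(a - w)`.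
    refine ⟨w + (z + 1) • z⁻¹ • (a - w), v + (z + 1) • u, ?_, ?_⟩
    · refine mem_of_mem_of_eq
        (G'.add_mem hv (G'.smul_mem (z + 1) (G'.smul_mem z⁻¹ h1))) rfl ?_
      simp [hz]
    · refine mem_of_mem_of_eq (G.add_mem hw (G.smul_mem (z + 1) ha)) rfl ?_
      have : z • (z + 1) • z⁻¹ • (a - w) = (z + 1) • (a - w) := by
        rw [smul_comm z, smul_inv_smul₀ hz]
      change y - w + (z + 1) • a = y + z • (w + (z + 1) • z⁻¹ • (a - w))
      rw [smul_add, this]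
      module
  · obtain ⟨u, hu, hu'⟩ := hx
    have : u = 0 := h.2 u ⟨z • x, hu', G'.smul_mem z hu⟩
    subst this
    exact (smul_eq_zero.1 (hfun _ hu')).resolve_left hz

theorem exists_mem_sub_orthogonal [CompleteSpace H] {G : Submodule ℝ (H × H)}
    (hG : IsClosed (G : Set (H × H))) (p : H × H) :
    ∃ q ∈ G, ∀ r ∈ G, inner ℝ (p.1 - q.1) r.1 + inner ℝ (p.2 - q.2) r.2 = 0 := by
  -- The product `H × H` carries the sup norm; the projection is taken in its Hilbert space version.
  let L := WithLp.prodContinuousLinearEquiv 2 ℝ H H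
  let K : Submodule ℝ (WithLp 2 (H × H)) := G.comap (L : WithLp 2 (H × H) →ₗ[ℝ] H × H)
  have hK : IsClosed (K : Set (WithLp 2 (H × H))) := hG.preimage L.continuous
  have : CompleteSpace K := hK.completeSpace_coe
  refine ⟨L (K.starProjection (L.symm p)), K.starProjection_apply_mem _, fun r hr => ?_⟩
  have h := K.sub_starProjection_mem_orthogonal (L.symm p)
  have h1 := Submodule.inner_left_of_mem_orthogonal (K := K) (u := L.symm r)
    (by change L (L.symm r) ∈ G; simpa using hr) h
  rw [WithLp.prod_inner_apply] at h1
  exact h1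

theorem le_topologicalClosure_of_orthogonal [CompleteSpace H] {G G₀ : Submodule ℝ (H × H)}
    (hle : G₀ ≤ G) (hG : IsClosed (G : Set (H × H)))
    (h : ∀ x y, (x, y) ∈ G → (∀ r ∈ G₀, inner ℝ x r.1 + inner ℝ y r.2 = 0) → x = 0 ∧ y = 0) :
    G ≤ G₀.topologicalClosure := by
  intro p hp
  obtain ⟨q, hq, hr⟩ := exists_mem_sub_orthogonal G₀.isClosed_topologicalClosure p
  have hq' : q ∈ G := G₀.topologicalClosure_minimal hle hG hq
  obtain ⟨h1, h2⟩ := h (p.1 - q.1) (p.2 - q.2) (G.sub_mem hp hq')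
    fun r hr' => hr r (G₀.le_topologicalClosure hr')
  rwa [show p = q from Prod.ext (sub_eq_zero.1 h1) (sub_eq_zero.1 h2)]

/-- Von Neumann's argument that `1 + G'G` is onto: project `(y, 0)` onto `G`; orthogonality of the
residual `(y - w, -v)` to `G` says that `(v, y - w)` is in the adjoint. -/
theorem IsAdjointRel.exists_mem_relComp_sub [CompleteSpace H] {G G' : Submodule ℝ (H × H)}
    (hG : IsClosed (G : Set (H × H))) (h : IsAdjointRel G G') (y : H) :
    ∃ w, (w, y - w) ∈ relComp G G' := by
  obtain ⟨⟨w, v⟩, hq, hr⟩ := exists_mem_sub_orthogonal hG (y, 0)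
  refine ⟨w, v, hq, (h _ _).2 fun r hr' => ?_⟩
  have := hr r hr'
  simp only [zero_sub, inner_neg_left] at this
  rw [real_inner_comm, real_inner_comm (y - w)]
  linarith

theorem isClosed_of_mem_iff_inner {ι : Type*} {G : Submodule ℝ (H × H)} {F : ι → H × H}
    (h : ∀ x y, (x, y) ∈ G ↔ ∀ i, inner ℝ (F i).2 x = inner ℝ (F i).1 y) :
    IsClosed (G : Set (H × H)) := by
  have : (G : Set (H × H)) = ⋂ i, {p | inner ℝ (F i).2 p.1 = inner ℝ (F i).1 p.2} := by
    ext ⟨x, y⟩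
    simp [h]
  rw [this]
  exact isClosed_iInter fun i => isClosed_eq (by fun_prop) (by fun_prop)

theorem inner_eq_of_mem_topologicalClosure {ι : Type*} {F : ι → H × H} {x y : H}
    (h : ∀ i, inner ℝ (F i).2 x = inner ℝ (F i).1 y) {p : H × H}
    (hp : p ∈ (Submodule.span ℝ (Set.range F)).topologicalClosure) :
    inner ℝ p.2 x = inner ℝ p.1 y := by
  let N : Submodule ℝ (H × H) :=
    { carrier := {p | inner ℝ p.2 x = inner ℝ p.1 y}
      zero_mem' := by simp
      add_mem' := fun {a b} ha hb => by
        simp only [Set.mem_ofPred_eq, Prod.snd_add, Prod.fst_add, inner_add_left] at ha hb ⊢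
        rw [ha, hb]
      smul_mem' := fun c a ha => by
        simp only [Set.mem_ofPred_eq, Prod.smul_snd, Prod.smul_fst, real_inner_smul_left] at ha ⊢
        rw [ha] }
  have hN : IsClosed (N : Set (H × H)) := isClosed_eq (by fun_prop) (by fun_prop)
  refine (Submodule.topologicalClosure_minimal _ ?_ hN) hp
  rw [Submodule.span_le]
  rintro _ ⟨i, rfl⟩
  exact h i

theorem isAdjointRel_of_le_topologicalClosure {ι : Type*} {G G' : Submodule ℝ (H × H)}
    {F : ι → H × H} (hF : ∀ i, F i ∈ G)
    (hG : G ≤ (Submodule.span ℝ (Set.range F)).topologicalClosure)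
    (h : ∀ x y, (x, y) ∈ G' ↔ ∀ i, inner ℝ (F i).2 x = inner ℝ (F i).1 y) :
    IsAdjointRel G G' := fun x y => by
  rw [h]
  exact ⟨fun hi p hp => inner_eq_of_mem_topologicalClosure hi (hG hp), fun hp i => hp _ (hF i)⟩

end LinearRelations

/-! ### Forms of type `‖T x‖²`: associated operators, resolvent sets, cores -/

section Forms

variable {H : Type*} [NormedAddCommGroup H] [InnerProductSpace ℝ H]

theorem QForm.ofOperator_operatorGraph {t : H →ₗ.[ℝ] H} {G' : Submodule ℝ (H × H)}
    (h : IsAdjointRel t.graph G') :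
    (QForm.ofOperator t).operatorGraph = relComp t.graph G' := by
  ext ⟨y, w⟩
  rw [mem_relComp]
  constructor
  · rintro ⟨hy, hx⟩
    refine ⟨t ⟨y, hy⟩, t.mem_graph ⟨y, hy⟩, (h _ _).2 fun p hp => ?_⟩
    obtain ⟨x, rfl, h2⟩ := t.mem_graph_iff'.1 hp
    exact hx x
  · rintro ⟨u, hu, hu'⟩
    obtain ⟨y', hy, rfl⟩ := t.mem_graph_iff.1 hu
    obtain rfl : (y' : H) = y := hy
    exact ⟨y'.2, fun x => (h _ _).1 hu' _ (t.mem_graph x)⟩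

theorem QForm.inner_operatorGraph (Q : QForm H) {p q : H × H} (hp : p ∈ Q.operatorGraph)
    (hq : q ∈ Q.operatorGraph) : inner ℝ p.1 q.2 = inner ℝ p.2 q.1 := by
  obtain ⟨h1, h1'⟩ := hp
  obtain ⟨h2, h2'⟩ := hq
  rw [← h2' ⟨p.1, h1⟩, Q.symm, h1' ⟨q.1, h2⟩, real_inner_comm]

/-- Boundedness of the inverse is automatic: the inverse is symmetric and everywhere defined, so the
Hellinger–Toeplitz theorem applies. -/
theorem QForm.mem_opResolventSet_operator_iff [CompleteSpace H] (Q : QForm H)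
    (hQ : Dense (Q.domain : Set H)) (z : ℝ) :
    z ∈ opResolventSet Q.operator ↔ IsRegularAt Q.operatorGraph z := by
  rw [← Q.operator_graph hQ]
  constructor
  · rintro ⟨R, hR, hR'⟩
    refine ⟨fun y => ⟨R y, ?_⟩, fun x hx => ?_⟩
    · obtain ⟨h, he⟩ := hR y
      exact (LinearPMap.image_iff h).1 (sub_eq_iff_eq_add.1 he).symm
    · obtain ⟨x', rfl, h2⟩ := (LinearPMap.mem_graph_iff _).1 hx
      rw [← hR' x', h2]
      simp
  · rintro ⟨h1, h2⟩
    choose f hf using h1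
    have huniq : ∀ x y, (x, y + z • x) ∈ Q.operator.graph → f y = x := fun x y hx => by
      refine sub_eq_zero.1 (h2 _ (mem_of_mem_of_eq (Submodule.sub_mem _ (hf y) hx) rfl ?_))
      simp [smul_sub]
    let S : H →ₗ[ℝ] H :=
      { toFun := f
        map_add' := fun a b => huniq _ _ <|
          mem_of_mem_of_eq (Submodule.add_mem _ (hf a) (hf b)) rfl (by simp only; module)
        map_smul' := fun c a => huniq _ _ <|
          mem_of_mem_of_eq (Submodule.smul_mem _ c (hf a)) rfl
            (by simp only [RingHom.id_apply]; module) }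
    have hS : S.IsSymmetric := fun a b => by
      have h3 := Q.inner_operatorGraph (Q.operator_graph hQ ▸ hf a) (Q.operator_graph hQ ▸ hf b)
      simp only [inner_add_right, inner_add_left, real_inner_smul_left,
        real_inner_smul_right] at h3
      change inner ℝ (f a) b = inner ℝ a (f b)
      linarith
    refine ⟨⟨S, hS.continuous⟩, fun y => ?_, fun x => ?_⟩
    · have hy := hf y
      have hd : f y ∈ Q.operator.domain := LinearPMap.mem_domain_of_mem_graph hy
      refine ⟨hd, ?_⟩
      change Q.operator ⟨f y, hd⟩ - z • f y = y
      rw [sub_eq_iff_eq_add]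
      exact ((LinearPMap.image_iff hd).2 hy).symm
    · refine huniq _ _ ?_
      rw [sub_add_cancel]
      exact Q.operator.mem_graph x

/-- The form norm of `‖t x‖²` is the graph norm of `t`, so form closures become closures of graphs
in `H × H`. -/
theorem QForm.mem_closureDomain_ofOperator (t : H →ₗ.[ℝ] H) (S : Submodule ℝ H) (x : t.domain) :
    x ∈ (QForm.ofOperator t).closureDomain S ↔
      ((x : H), t x) ∈ (t.graph ⊓ S.comap (LinearMap.fst ℝ H H)).topologicalClosure := by
  have key : ∀ u : ℕ → t.domain,
      Tendsto (fun n => (QForm.ofOperator t).normSq (x - u n)) atTop (𝓝 0) ↔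
      Tendsto (fun n => ((u n : H), t (u n))) atTop (𝓝 ((x : H), t x)) := by
    intro u
    have hn : ∀ n, (QForm.ofOperator t).normSq (x - u n) =
        ‖t x - t (u n)‖ ^ 2 + ‖(x : H) - u n‖ ^ 2 := fun n => by
      rw [← t.map_sub, ← real_inner_self_eq_norm_sq]
      rfl
    simp only [hn]
    rw [nhds_prod_eq, tendsto_prod_iff',
      tendsto_iff_norm_sub_tendsto_zero (f := fun n => (u n : H)),
      tendsto_iff_norm_sub_tendsto_zero (f := fun n => t (u n))]
    simp only [norm_sub_rev _ (x : H), norm_sub_rev _ (t x)]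
    have aux : ∀ a : ℕ → ℝ, (∀ n, 0 ≤ a n) → Tendsto (fun n => a n ^ 2) atTop (𝓝 0) →
        Tendsto a atTop (𝓝 0) := fun a ha h => by
      have := (Real.continuous_sqrt.tendsto 0).comp h
      rw [Real.sqrt_zero] at this
      exact this.congr fun n => Real.sqrt_sq (ha n)
    constructor
    · intro h
      exact ⟨aux _ (fun n => norm_nonneg _) (squeeze_zero (fun n => sq_nonneg _)
          (fun n => le_add_of_nonneg_left (sq_nonneg _)) h),
        aux _ (fun n => norm_nonneg _) (squeeze_zero (fun n => sq_nonneg _)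
          (fun n => le_add_of_nonneg_right (sq_nonneg _)) h)⟩
    · rintro ⟨h1, h2⟩
      simpa using (h2.pow 2).add (h1.pow 2)
  rw [← SetLike.mem_coe, Submodule.topologicalClosure_coe, mem_closure_iff_seq_limit]
  constructor
  · rintro ⟨u, hu, hu'⟩
    exact ⟨_, fun n => ⟨t.mem_graph (u n), hu n⟩, (key u).1 hu'⟩
  · rintro ⟨v, hv, hv'⟩
    choose u hu using fun n => t.mem_graph_iff'.1 (hv n).1
    refine ⟨u, fun n => ?_, (key u).2 (hv'.congr fun n => (hu n).symm)⟩
    have := (hv n).2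
    rwa [← hu n] at this

theorem QForm.closureRestrict_eq_of_forall (Q : QForm H) (S : Submodule ℝ H)
    (h : ∀ x, x ∈ Q.closureDomain S) : Q.closureRestrict S = Q := by
  have hd : (Q.closureDomain S).map Q.domain.subtype = Q.domain := by
    rw [show Q.closureDomain S = ⊤ from eq_top_iff.2 fun x _ => h x, Submodule.map_subtype_top]
  -- The type of the form depends on its domain, so the domain is generalized before the equality is
  -- substituted.
  have key : ∀ (D : Submodule ℝ H) (hD : D ≤ Q.domain), D = Q.domain →
      ∀ (h1 : ∀ x y, Q.form.compl₁₂ (Submodule.inclusion hD) (Submodule.inclusion hD) x y =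
          Q.form.compl₁₂ (Submodule.inclusion hD) (Submodule.inclusion hD) y x)
        (h2 : ∀ x, 0 ≤ Q.form.compl₁₂ (Submodule.inclusion hD) (Submodule.inclusion hD) x x),
      QForm.mk D (Q.form.compl₁₂ (Submodule.inclusion hD) (Submodule.inclusion hD)) h1 h2 = Q := by
    rintro D hD rfl h1 h2
    rfl
  exact key _ _ hd _ _

theorem QForm.closureRestrict_ofOperator_eq_iff (t : H →ₗ.[ℝ] H) (S : Submodule ℝ H) :
    (QForm.ofOperator t).closureRestrict S = QForm.ofOperator t ↔
      t.graph ≤ (t.graph ⊓ S.comap (LinearMap.fst ℝ H H)).topologicalClosure := by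
  constructor
  · intro h p hp
    obtain ⟨x, rfl⟩ := t.mem_graph_iff'.1 hp
    rw [← QForm.mem_closureDomain_ofOperator]
    have hx : (x : H) ∈ ((QForm.ofOperator t).closureRestrict S).domain := by
      rw [h]
      exact x.2
    obtain ⟨x', hx', he⟩ := hx
    rwa [show x = x' from Subtype.ext he.symm]
  · intro h
    refine QForm.closureRestrict_eq_of_forall _ _ fun x => ?_
    exact (QForm.mem_closureDomain_ofOperator t S x).2 (h (t.mem_graph x))

theorem graph_inf_comap_fst_span {ι : Type*} {t : H →ₗ.[ℝ] H} {E T : ι → H}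
    (h : ∀ i, (E i, T i) ∈ t.graph) :
    t.graph ⊓ (Submodule.span ℝ (Set.range E)).comap (LinearMap.fst ℝ H H) =
      Submodule.span ℝ (Set.range fun i => (E i, T i)) := by
  have hle : Submodule.span ℝ (Set.range fun i => (E i, T i)) ≤ t.graph := by
    rw [Submodule.span_le]
    rintro _ ⟨i, rfl⟩
    exact h i
  have hmap : Submodule.span ℝ (Set.range E) =
      (Submodule.span ℝ (Set.range fun i => (E i, T i))).map (LinearMap.fst ℝ H H) := by
    rw [Submodule.map_span, ← Set.range_comp]
    rfl
  refine le_antisymm ?_ (le_inf hle ?_)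
  · rintro ⟨x, y⟩ ⟨hp, hS⟩
    rw [hmap] at hS
    obtain ⟨⟨x', y'⟩, hq, he⟩ := hS
    obtain rfl : x' = x := he
    obtain rfl : y = y' := t.mem_graph_snd_inj' hp (hle hq) rfl
    exact hq
  · rw [hmap]
    exact Submodule.le_comap_map _ _

end Forms

/-! ### The abstract theorem for a formally adjoint pair with `dd = 0` -/

section AdjointPair

variable {H : Type*} [NormedAddCommGroup H] [InnerProductSpace ℝ H] [CompleteSpace H]
  {ι : Type*} {d e t : H →ₗ.[ℝ] H} {E B C : ι → H}

/-- The map `(x, u, v) ↦ (x, u + v)` is bounded below on triples with `u = d x` and `(x, v)` in the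
closed span of the `(E i, B i)`, since there `u ⊥ v`. Its range is therefore closed, and it contains
every generator `(E i, B i + C i)`. -/
theorem exists_add_of_mem_closure_span_add
    (hd : ∀ x y, (x, y) ∈ d.graph ↔ ∀ i, inner ℝ (B i) x = inner ℝ (E i) y)
    (hEC : ∀ i, (E i, C i) ∈ d.graph)
    (hdd : ∀ x y, (x, y) ∈ d.graph → (y, 0) ∈ d.graph) {p : H × H}
    (hp : p ∈ (Submodule.span ℝ (Set.range fun i => (E i, B i + C i))).topologicalClosure) :
    ∃ u v, (p.1, u) ∈ d.graph ∧
      (p.1, v) ∈ (Submodule.span ℝ (Set.range fun i => (E i, B i))).topologicalClosure ∧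
      p.2 = u + v := by
  have hdc : IsClosed (d.graph : Set (H × H)) :=
    isClosed_of_mem_iff_inner (F := fun i => (E i, B i)) hd
  set Se := (Submodule.span ℝ (Set.range fun i => (E i, B i))).topologicalClosure with hSe
  -- triples `(x, u, v)` with `(x, u)` in the graph of `d` and `(x, v)` in `Se`
  let π₁ : H × H × H →L[ℝ] H × H :=
    (ContinuousLinearMap.fst ℝ H (H × H)).prod
      ((ContinuousLinearMap.fst ℝ H H).comp (ContinuousLinearMap.snd ℝ H (H × H)))
  let π₂ : H × H × H →L[ℝ] H × H :=
    (ContinuousLinearMap.fst ℝ H (H × H)).prod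
      ((ContinuousLinearMap.snd ℝ H H).comp (ContinuousLinearMap.snd ℝ H (H × H)))
  let W : Submodule ℝ (H × H × H) :=
    d.graph.comap (π₁ : H × H × H →ₗ[ℝ] H × H) ⊓ Se.comap (π₂ : H × H × H →ₗ[ℝ] H × H)
  have hW : IsClosed (W : Set (H × H × H)) :=
    (hdc.preimage π₁.continuous).inter
      ((Submodule.isClosed_topologicalClosure _).preimage π₂.continuous)
  have : CompleteSpace W := hW.completeSpace_coe
  let Φ : H × H × H →L[ℝ] H × H :=
    (ContinuousLinearMap.fst ℝ H (H × H)).prod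
      (((ContinuousLinearMap.fst ℝ H H) + (ContinuousLinearMap.snd ℝ H H)).comp
        (ContinuousLinearMap.snd ℝ H (H × H)))
  let Ψ : W →L[ℝ] H × H := Φ.comp W.subtypeL
  have hbound : ∀ w : W, ‖w‖ ≤ ((1 : NNReal) : ℝ) * ‖Ψ w‖ := by
    rintro ⟨⟨x, u, v⟩, h1, h2⟩
    have h1' : (x, u) ∈ d.graph := h1
    -- Here `(u, 0)` is in the graph of `d`, and the defining relation of `d` extends to the closure
    -- containing `(x, v)`.
    have h0 : inner ℝ v u = 0 := by
      exact (inner_eq_of_mem_topologicalClosure ((hd _ _).1 (hdd _ _ h1')) h2).trans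
        (inner_zero_right _)
    have hn : ‖u + v‖ * ‖u + v‖ = ‖u‖ * ‖u‖ + ‖v‖ * ‖v‖ :=
      norm_add_sq_eq_norm_sq_add_norm_sq_of_inner_eq_zero _ _ (by rw [real_inner_comm]; exact h0)
    have hu : ‖u‖ ≤ ‖u + v‖ := by nlinarith [norm_nonneg u, norm_nonneg v, norm_nonneg (u + v)]
    have hv : ‖v‖ ≤ ‖u + v‖ := by nlinarith [norm_nonneg u, norm_nonneg v, norm_nonneg (u + v)]
    rw [NNReal.coe_one, one_mul]
    change ‖(x, u, v)‖ ≤ ‖(x, u + v)‖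
    simp only [Prod.norm_def]
    exact max_le_max le_rfl (max_le hu hv)
  have hanti : AntilipschitzWith 1 Ψ := Ψ.antilipschitz_of_bound hbound
  have hr : IsClosed (Set.range Ψ) := hanti.isClosed_range Ψ.uniformContinuous
  have hmem : p ∈ LinearMap.range (Ψ : W →ₗ[ℝ] H × H) := by
    refine Submodule.topologicalClosure_minimal _ ?_ hr hp
    rw [Submodule.span_le]
    rintro _ ⟨i, rfl⟩
    refine ⟨⟨(E i, C i, B i), hEC i, Submodule.le_topologicalClosure _
      (Submodule.subset_span ⟨i, rfl⟩)⟩, ?_⟩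
    exact Prod.ext rfl (add_comm _ _)
  obtain ⟨⟨⟨x, u, v⟩, h1, h2⟩, rfl⟩ := hmem
  exact ⟨u, v, h1, h2, rfl⟩

/-- A pair `(x, y)` in the graph of `d` orthogonal to the span has `(y, -x)` in the graph of `e`. If
that pair is in the closed span of the `(E i, B i)`, to which `d` is adjoint, then `-‖x‖² = ‖y‖²`.
-/
theorem graph_le_closure_span
    (hd : ∀ x y, (x, y) ∈ d.graph ↔ ∀ i, inner ℝ (B i) x = inner ℝ (E i) y)
    (he : ∀ x y, (x, y) ∈ e.graph ↔ ∀ i, inner ℝ (C i) x = inner ℝ (E i) y)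
    (hEC : ∀ i, (E i, C i) ∈ d.graph)
    (h : ∀ x y, (x, y) ∈ d.graph → (y, -x) ∈ e.graph →
      (y, -x) ∈ (Submodule.span ℝ (Set.range fun i => (E i, B i))).topologicalClosure) :
    d.graph ≤ (Submodule.span ℝ (Set.range fun i => (E i, C i))).topologicalClosure := by
  refine le_topologicalClosure_of_orthogonal ?_
    (isClosed_of_mem_iff_inner (F := fun i => (E i, B i)) hd) fun x y hxy horth => ?_
  · rw [Submodule.span_le]
    rintro _ ⟨i, rfl⟩
    exact hEC i
  · have hy : (y, -x) ∈ e.graph := (he _ _).2 fun i => by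
      have := horth _ (Submodule.subset_span ⟨i, rfl⟩)
      simp only at this
      rw [inner_neg_right, real_inner_comm, real_inner_comm x]
      linarith
    have h0 := inner_eq_of_mem_topologicalClosure ((hd _ _).1 hxy) (h x y hxy hy)
    simp only [inner_neg_left, real_inner_self_eq_norm_sq] at h0
    have hx0 : ‖x‖ ^ 2 = 0 := by nlinarith [sq_nonneg ‖x‖, sq_nonneg ‖y‖]
    have hy0 : ‖y‖ ^ 2 = 0 := by nlinarith [sq_nonneg ‖x‖, sq_nonneg ‖y‖]
    simpa using And.intro hx0 hy0

/-- If the sum `t` of formally adjoint maximal operators `d`, `e` with `d d = 0` is the closure of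
its restriction to the span `S` of the `E i`, then so are `d` and `e`, and the nonzero spectra of
the operators of the three forms agree. -/
theorem closureRestrict_eq_and_opSpectrum_eq
    (hE : Dense (Submodule.span ℝ (Set.range E) : Set H))
    (hd : ∀ x y, (x, y) ∈ d.graph ↔ ∀ i, inner ℝ (B i) x = inner ℝ (E i) y)
    (he : ∀ x y, (x, y) ∈ e.graph ↔ ∀ i, inner ℝ (C i) x = inner ℝ (E i) y)
    (ht : ∀ x y, (x, y) ∈ t.graph ↔ ∀ i, inner ℝ (B i + C i) x = inner ℝ (E i) y)
    (hEC : ∀ i, (E i, C i) ∈ d.graph) (hEB : ∀ i, (E i, B i) ∈ e.graph)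
    (hdd : ∀ x y, (x, y) ∈ d.graph → (y, 0) ∈ d.graph)
    (hQ : (QForm.ofOperator t).closureRestrict (Submodule.span ℝ (Set.range E)) =
      QForm.ofOperator t) :
    (QForm.ofOperator d).closureRestrict (Submodule.span ℝ (Set.range E)) = QForm.ofOperator d ∧
    (QForm.ofOperator e).closureRestrict (Submodule.span ℝ (Set.range E)) = QForm.ofOperator e ∧
    opSpectrum (QForm.ofOperator d).operator \ {0} =
      opSpectrum (QForm.ofOperator t).operator \ {0} ∧
    opSpectrum (QForm.ofOperator t).operator \ {0} =
      opSpectrum (QForm.ofOperator e).operator \ {0} := by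
  have hadd : ∀ x u v, (x, u) ∈ d.graph → (x, v) ∈ e.graph → (x, u + v) ∈ t.graph :=
    fun x u v hu hv => (ht _ _).2 fun i => by
      rw [inner_add_left, inner_add_right, (hd _ _).1 hu, (he _ _).1 hv]
  have hEt : ∀ i, (E i, B i + C i) ∈ t.graph := fun i =>
    add_comm (C i) (B i) ▸ hadd _ _ _ (hEC i) (hEB i)
  have hdc : IsClosed (d.graph : Set (H × H)) :=
    isClosed_of_mem_iff_inner (F := fun i => (E i, B i)) hd
  have hec : IsClosed (e.graph : Set (H × H)) :=
    isClosed_of_mem_iff_inner (F := fun i => (E i, C i)) he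
  have hle : (Submodule.span ℝ (Set.range fun i => (E i, B i))).topologicalClosure ≤ e.graph := by
    refine Submodule.topologicalClosure_minimal _ ?_ hec
    rw [Submodule.span_le]
    rintro _ ⟨i, rfl⟩
    exact hEB i
  rw [QForm.closureRestrict_ofOperator_eq_iff, graph_inf_comap_fst_span hEt] at hQ
  have hsplit := fun p (hp : p ∈ t.graph) =>
    exists_add_of_mem_closure_span_add hd hEC hdd (hQ hp)
  have hdcl : d.graph ≤
      (Submodule.span ℝ (Set.range fun i => (E i, C i))).topologicalClosure := by
    refine graph_le_closure_span hd he hEC fun x y hxy hy => ?_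
    have hy0 := hdd _ _ hxy
    -- As `d y = 0`, the `d` part of the splitting vanishes, and `-x` is entirely the part from the
    -- closure.
    obtain ⟨u, v, hu, hv, huv⟩ := hsplit (y, 0 + -x) (hadd _ _ _ hy0 hy)
    obtain rfl : u = 0 := d.mem_graph_snd_inj' hu hy0 rfl
    simp only [zero_add] at huv
    rwa [huv]
  have hecl : e.graph ≤
      (Submodule.span ℝ (Set.range fun i => (E i, B i))).topologicalClosure :=
    -- With the roles exchanged, the required membership is the core property of `d` just proved.
    graph_le_closure_span he hd hEB fun x y _ hy => hdcl hy
  have had : IsAdjointRel d.graph e.graph := isAdjointRel_of_le_topologicalClosure hEC hdcl he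
  have hda : IsAdjointRel e.graph d.graph := isAdjointRel_of_le_topologicalClosure hEB hecl hd
  have htt : IsAdjointRel t.graph t.graph := isAdjointRel_of_le_topologicalClosure hEt hQ ht
  -- `ee = 0` is inherited from `dd = 0` by taking adjoints; it is not assumed.
  have hee : ∀ x y, (x, y) ∈ e.graph → (y, 0) ∈ e.graph := fun x y hxy =>
    (had _ _).2 fun p hp => by
      have := (had _ _).1 hxy _ (hdd _ _ hp)
      simpa using this.symm
  have hT : ∀ x y, (x, y) ∈ t.graph ↔ ∃ u v, (x, u) ∈ d.graph ∧ (x, v) ∈ e.graph ∧ y = u + v := by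
    refine fun x y => ⟨fun h => ?_, ?_⟩
    · obtain ⟨u, v, hu, hv, huv⟩ := hsplit _ h
      exact ⟨u, v, hu, hle hv, huv⟩
    · rintro ⟨u, v, hu, hv, rfl⟩
      exact hadd _ _ _ hu hv
  have hC := relComp_sum_self hT hdd hee
  have hC' : ∀ x w, (x, w) ∈ relComp t.graph t.graph ↔ ∃ a b p q, (x, a) ∈ e.graph ∧
      (x, b) ∈ d.graph ∧ (a, p) ∈ d.graph ∧ (b, q) ∈ e.graph ∧ w = p + q := by
    refine fun x w => (hC x w).trans ⟨?_, ?_⟩ <;>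
    · rintro ⟨a, b, p, q, ha, hb, hp, hq, rfl⟩
      exact ⟨b, a, q, p, hb, ha, hq, hp, add_comm _ _⟩
  have hdense : ∀ (s : H →ₗ.[ℝ] H) (T : ι → H), (∀ i, (E i, T i) ∈ s.graph) →
      Dense ((QForm.ofOperator s).domain : Set H) := fun s T hs => by
    refine hE.mono (Submodule.span_le.2 ?_)
    rintro _ ⟨i, rfl⟩
    exact LinearPMap.mem_domain_of_mem_graph (hs i)
  have hreg : ∀ z : ℝ, z ≠ 0 →
      (IsRegularAt (relComp d.graph e.graph) z ↔ IsRegularAt (relComp t.graph t.graph) z) ∧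
      (IsRegularAt (relComp t.graph t.graph) z ↔ IsRegularAt (relComp e.graph d.graph) z) := by
    intro z hz
    have hda' : IsRegularAt (relComp d.graph e.graph) z → IsRegularAt (relComp e.graph d.graph) z :=
      IsRegularAt.relComp_swap hz (fun y hy => d.graph_fst_eq_zero_snd hy rfl)
        (hda.exists_mem_relComp_sub hec)
    have had' : IsRegularAt (relComp e.graph d.graph) z → IsRegularAt (relComp d.graph e.graph) z :=
      IsRegularAt.relComp_swap hz (fun y hy => e.graph_fst_eq_zero_snd hy rfl)
        (had.exists_mem_relComp_sub hdc)
    exact ⟨⟨fun h => h.sum hz hC hdd hee (hda' h), fun h => h.of_sum hz hC hdd hee⟩,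
      ⟨fun h => h.of_sum hz hC' hee hdd, fun h => (had' h).sum hz hC hdd hee h⟩⟩
  refine ⟨?_, ?_, ?_, ?_⟩
  · rwa [QForm.closureRestrict_ofOperator_eq_iff, graph_inf_comap_fst_span hEC]
  · rwa [QForm.closureRestrict_ofOperator_eq_iff, graph_inf_comap_fst_span hEB]
  · ext z
    simp only [opSpectrum, Set.mem_sdiff, Set.mem_compl_iff, Set.mem_singleton_iff]
    refine and_congr_left fun hz => not_congr ?_
    rw [QForm.mem_opResolventSet_operator_iff _ (hdense d C hEC),
      QForm.mem_opResolventSet_operator_iff _ (hdense t _ hEt),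
      QForm.ofOperator_operatorGraph had, QForm.ofOperator_operatorGraph htt]
    exact (hreg z hz).1
  · ext z
    simp only [opSpectrum, Set.mem_sdiff, Set.mem_compl_iff, Set.mem_singleton_iff]
    refine and_congr_left fun hz => not_congr ?_
    rw [QForm.mem_opResolventSet_operator_iff _ (hdense e B hEB),
      QForm.mem_opResolventSet_operator_iff _ (hdense t _ hEt),
      QForm.ofOperator_operatorGraph hda, QForm.ofOperator_operatorGraph htt]
    exact (hreg z hz).2

end AdjointPair

/-! ### `ℓ²` of a weighted complex and its characteristic functions -/

section Complex

variable {V : Type*} {K : SComplex V} {m : Weight K}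

instance [Countable V] : Countable (Simplex m) := by
  unfold Simplex
  infer_instance

theorem Simplex.verts_injective : Function.Injective (Simplex.verts : Simplex m → Finset V) :=
  fun _ _ h => Subtype.ext (Subtype.ext h)

theorem Simplex.wt_pos (σ : Simplex m) : 0 < σ.wt := m.pos _

theorem Simplex.finite_faces (σ : Simplex m) : {τ : Simplex m | τ.IsFace σ}.Finite :=
  (σ.verts.powerset.finite_toSet.preimage Simplex.verts_injective.injOn).subset
    fun _ h => Finset.mem_coe.2 (Finset.mem_powerset.2 h.1)

theorem char_self (τ : Simplex m) : char τ τ = 1 := by simp [char]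

theorem char_of_ne {τ σ : Simplex m} (h : σ ≠ τ) : char τ σ = 0 := by simp [char, h]

theorem Coboundary.sign_eq_zero (δ : Coboundary m) {τ σ : Simplex m} (h : ¬ τ.IsFace σ) :
    δ.sign τ σ = 0 := by
  by_contra h0
  exact h ((δ.char_ne_zero τ σ).1 h0)

theorem Coboundary.sign_sq_le (δ : Coboundary m) (τ σ : Simplex m) : δ.sign τ σ ^ 2 ≤ 1 := by
  rw [← sq_abs]
  exact pow_le_one₀ (abs_nonneg _) (δ.abs_sign_le τ σ)

theorem L2.fn_toLp {f : Fn m} (h : MemLp f 2 m.measure) : L2.fn m (h.toLp f) = f :=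
  eq_of_ae_eq h.coeFn_toLp

theorem L2.fn_injective : Function.Injective (L2.fn m) := fun _ _ h =>
  Lp.ext (Eventually.of_forall fun σ => congrFun h σ)

theorem finite_support_char (τ : Simplex m) : (Function.support (char τ)).Finite :=
  (Set.finite_singleton τ).subset fun σ hσ => by
    by_contra h
    exact hσ (char_of_ne h)

theorem Coboundary.finite_support_boundary (δ : Coboundary m) (τ : Simplex m) :
    (Function.support fun ρ : Simplex m => 1 / ρ.wt * (τ.wt * δ.sign ρ τ)).Finite :=
  τ.finite_faces.subset fun ρ hρ => by
    by_contra h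
    exact hρ (by simp [δ.sign_eq_zero h])

theorem Coboundary.boundary_apply (δ : Coboundary m) {ω : Fn m} (h : ω ∈ δ.boundary.domain)
    (ρ : Simplex m) : δ.boundary ⟨ω, h⟩ ρ =
      1 / ρ.wt * ∑' τ : {τ : Simplex m // ρ.IsFace τ}, τ.1.wt * ω τ * δ.sign ρ τ := rfl

theorem mem_graph_maxRealization {T : Fn m →ₗ.[ℝ] Fn m} {f g : L2 m} :
    (f, g) ∈ (maxRealization T).graph ↔ ∃ h : L2.fn m f ∈ T.domain, T ⟨_, h⟩ = L2.fn m g := by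
  rw [LinearPMap.mem_graph_iff]
  constructor
  · rintro ⟨⟨f', hf', hf''⟩, h, rfl⟩
    obtain rfl : f' = f := h
    exact ⟨hf', (L2.fn_toLp hf'').symm⟩
  · rintro ⟨h, h'⟩
    have hT : MemLp (T ⟨_, h⟩) 2 m.measure := h' ▸ Lp.memLp g
    exact ⟨⟨f, h, hT⟩, rfl, L2.fn_injective ((L2.fn_toLp hT).trans h')⟩

theorem Coboundary.mem_graph_up (δ : Coboundary m) {f g : L2 m} :
    (f, g) ∈ (maxRealization (δ.op .up)).graph ↔
    δ.toLin (L2.fn m f) = L2.fn m g :=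
  mem_graph_maxRealization.trans ⟨fun h => h.2, fun h => ⟨trivial, h⟩⟩

variable [Countable V]

theorem integrable_measure_iff {f : Fn m} :
    Integrable f m.measure ↔ Summable fun σ => σ.wt * |f σ| := by
  unfold Weight.measure
  rw [integrable_sum_dirac_iff fun _ => ENNReal.ofReal_ne_top]
  simp only [ENNReal.toReal_ofReal (Simplex.wt_pos _).le, Real.norm_eq_abs]

theorem memLp_two_measure_iff {f : Fn m} :
    MemLp f 2 m.measure ↔ Summable fun σ => σ.wt * f σ ^ 2 := by
  rw [memLp_two_iff_integrable_sq (Measurable.of_discrete).aestronglyMeasurable,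
    integrable_measure_iff]
  simp only [abs_sq]

theorem hasSum_inner (f g : L2 m) :
    HasSum (fun σ => σ.wt * (L2.fn m f σ * L2.fn m g σ)) (inner ℝ f g) := by
  rw [L2.inner_def]
  have h := hasSum_integral_measure (f := fun σ => inner ℝ (f σ) (g σ))
    (μ := fun σ : Simplex m => ENNReal.ofReal σ.wt • Measure.dirac σ)
    (L2.integrable_inner (𝕜 := ℝ) f g)
  have he : (fun σ : Simplex m => σ.wt * (L2.fn m f σ * L2.fn m g σ)) = fun σ : Simplex m =>
      ∫ x, inner ℝ (f x) (g x) ∂(ENNReal.ofReal σ.wt • Measure.dirac σ) := funext fun σ => by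
    rw [integral_smul_measure, integral_dirac, ENNReal.toReal_ofReal (Simplex.wt_pos _).le,
      smul_eq_mul, real_inner_comm]
    rfl
  rw [he]
  exact h

/-- Local summability and `|a| ≤ 1 + a²` make `∂` defined on all of `ℓ²`. -/
theorem mem_F1_of_L2 (hm : m.LocallySummable) (f : L2 m) : L2.fn m f ∈ F1 m := fun τ => by
  have hf : MemLp (L2.fn m f) 2 m.measure := Lp.memLp f
  have h2 := (memLp_two_measure_iff.1 hf).subtype {σ : Simplex m | τ.IsFace σ}
  refine Summable.of_nonneg_of_le
    (fun σ => mul_nonneg (Simplex.wt_pos _).le (abs_nonneg _)) (fun σ => ?_) ((hm τ).add h2)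
  have h0 := Simplex.wt_pos σ.1
  change σ.1.wt * |L2.fn m f σ| ≤ σ.1.wt + σ.1.wt * L2.fn m f σ ^ 2
  rw [← sq_abs]
  nlinarith [sq_nonneg (|L2.fn m f σ| - 1), sq_nonneg (|L2.fn m f σ|),
    mul_nonneg h0.le (sq_nonneg (|L2.fn m f σ| - 1)), mul_nonneg h0.le (abs_nonneg (L2.fn m f σ))]

theorem memLp_of_finite_support {f : Fn m} (h : (Function.support f).Finite) :
    MemLp f 2 m.measure :=
  memLp_two_measure_iff.2 <| summable_of_hasFiniteSupport <|
    h.subset fun σ hσ h0 => hσ (by simp [h0])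

/-- The characteristic function of a simplex as an element of `ℓ²`. -/
def charL2 (τ : Simplex m) : L2 m := (memLp_of_finite_support (finite_support_char τ)).toLp _

theorem fn_charL2 (τ : Simplex m) : L2.fn m (charL2 τ) = char τ := L2.fn_toLp _

theorem inner_charL2 (τ : Simplex m) (f : L2 m) :
    inner ℝ (charL2 τ) f = τ.wt * L2.fn m f τ := by
  rw [(hasSum_inner _ f).unique (hasSum_single τ fun σ hσ => ?_), fn_charL2, char_self, one_mul]
  rw [fn_charL2, char_of_ne hσ]
  simp

theorem span_charL2 : Submodule.span ℝ (Set.range (charL2 (m := m))) = finSupp m := by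
  classical
  refine le_antisymm (Submodule.span_le.2 ?_) fun f hf => ?_
  · rintro _ ⟨τ, rfl⟩
    change (Function.support (L2.fn m (charL2 τ))).Finite
    rw [fn_charL2]
    exact finite_support_char τ
  · have hf' : (Function.support (L2.fn m f)).Finite := hf
    have : f = ∑ τ ∈ hf'.toFinset, L2.fn m f τ • charL2 τ := by
      refine L2.fn_injective (funext fun σ => ?_)
      rw [map_sum, Finset.sum_apply]
      simp only [map_smul, Pi.smul_apply, fn_charL2, smul_eq_mul]
      rw [Finset.sum_eq_single σ, char_self, mul_one]
      · intro τ _ hτ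
        rw [char_of_ne hτ.symm, mul_zero]
      · intro h
        rw [char_self, mul_one]
        simpa using h
    rw [this]
    exact Submodule.sum_mem _ fun τ _ => Submodule.smul_mem _ _ (Submodule.subset_span ⟨τ, rfl⟩)

theorem dense_span_charL2 : Dense (Submodule.span ℝ (Set.range (charL2 (m := m))) : Set (L2 m)) := by
  rw [Submodule.dense_iff_topologicalClosure_eq_top, Submodule.topologicalClosure_eq_top_iff,
    Submodule.eq_bot_iff]
  refine fun f hf => L2.fn_injective (funext fun τ => ?_)
  have h := Submodule.inner_right_of_mem_orthogonal
    (Submodule.subset_span (Set.mem_range_self τ)) hf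
  rw [inner_charL2] at h
  rw [map_zero]
  exact (mul_eq_zero.1 h).resolve_left (Simplex.wt_pos τ).ne'

/-! ### Green's formulas and application of the abstract theorem -/

namespace Coboundary

variable (δ : Coboundary m)

theorem memLp_coboundary_char (hm : m.LocallySummable) (τ : Simplex m) :
    MemLp (δ.toLin (char τ)) 2 m.measure := by
  rw [memLp_two_measure_iff]
  have h : Summable ((fun σ => σ.wt * δ.toLin (char τ) σ ^ 2) ∘
      (Subtype.val : {σ : Simplex m | τ.IsFace σ} → Simplex m)) := by
    refine Summable.of_nonneg_of_le
      (fun σ => mul_nonneg (Simplex.wt_pos _).le (sq_nonneg _)) (fun σ => ?_) (hm τ)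
    exact mul_le_of_le_one_right (Simplex.wt_pos _).le (δ.sign_sq_le τ σ)
  obtain ⟨a, ha⟩ := h
  refine ⟨a, (hasSum_subtype_iff_of_support_subset fun σ hσ => ?_).1 ha⟩
  by_contra h0
  refine hσ ?_
  have := δ.sign_eq_zero h0
  unfold sign at this
  simp [this]

/-- `δ 1_τ` as an element of `ℓ²`. -/
def coboundaryL2 (hm : m.LocallySummable) (τ : Simplex m) : L2 m :=
  (δ.memLp_coboundary_char hm τ).toLp _

/-- `∂ 1_τ` as an element of `ℓ²`. -/
def boundaryL2 (τ : Simplex m) : L2 m :=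
  (memLp_of_finite_support (δ.finite_support_boundary τ)).toLp _

theorem mem_domain_boundary (hm : m.LocallySummable) (f : L2 m) :
    L2.fn m f ∈ δ.boundary.domain := mem_F1_of_L2 hm f

/-- Green's formula tested on `1_τ`: both sides are the same sum over cofaces of `τ`, outside of
which `δ1_τ` vanishes. -/
theorem inner_coboundaryL2 (hm : m.LocallySummable) (τ : Simplex m) (f : L2 m) :
    inner ℝ (δ.coboundaryL2 hm τ) f = τ.wt * δ.boundary ⟨_, δ.mem_domain_boundary hm f⟩ τ := by
  rw [boundary_apply, one_div, mul_inv_cancel_left₀ (Simplex.wt_pos τ).ne']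
  have h := hasSum_inner (δ.coboundaryL2 hm τ) f
  rw [coboundaryL2, L2.fn_toLp] at h
  rw [← hasSum_subtype_iff_of_support_subset (s := {σ : Simplex m | τ.IsFace σ})] at h
  · refine h.tsum_eq.symm.trans (tsum_congr fun σ => ?_)
    simp only [Function.comp_apply, sign]
    ring
  · intro σ hσ
    by_contra h0
    refine hσ ?_
    have := δ.sign_eq_zero h0
    unfold sign at this
    simp [this]

theorem inner_boundaryL2 (τ : Simplex m) (f : L2 m) :
    inner ℝ (δ.boundaryL2 τ) f = τ.wt * δ.toLin (L2.fn m f) τ := by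
  have h := hasSum_inner (δ.boundaryL2 τ) f
  rw [boundaryL2, L2.fn_toLp] at h
  rw [← hasSum_subtype_iff_of_support_subset (s := {ρ : Simplex m | ρ.IsFace τ})] at h
  · have : Finite {ρ : Simplex m // ρ.IsFace τ} := τ.finite_faces.to_subtype
    rw [δ.apply_eq, ← tsum_eq_finsum (L := .unconditional _) (Set.toFinite _), ← tsum_mul_left]
    refine h.tsum_eq.symm.trans (tsum_congr fun ρ => ?_)
    have := (Simplex.wt_pos ρ.1).ne'
    simp only [Function.comp_apply, sign]
    field_simp
  · intro σ hσ
    by_contra h0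
    exact hσ (by simp [δ.sign_eq_zero h0])

theorem boundary_char (hm : m.LocallySummable) (τ : Simplex m) :
    δ.boundary ⟨_, δ.mem_domain_boundary hm (charL2 τ)⟩ = L2.fn m (δ.boundaryL2 τ) := by
  funext ρ
  rw [boundary_apply, boundaryL2, L2.fn_toLp]
  congr 1
  simp only [fn_charL2]
  by_cases h : ρ.IsFace τ
  · rw [tsum_eq_single ⟨τ, h⟩, char_self, mul_one]
    rintro ⟨σ, hσ⟩ hne
    rw [char_of_ne fun h' => hne (Subtype.ext h')]
    simp
  · rw [δ.sign_eq_zero h, mul_zero]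
    refine (tsum_congr fun σ => ?_).trans tsum_zero
    rw [char_of_ne fun h' => h (by simpa [h'] using σ.2)]
    simp

theorem mem_graph_down (hm : m.LocallySummable) {f g : L2 m} :
    (f, g) ∈ (maxRealization (δ.op .down)).graph ↔
      δ.boundary ⟨_, δ.mem_domain_boundary hm f⟩ = L2.fn m g :=
  mem_graph_maxRealization.trans ⟨fun h => h.2, fun h => ⟨mem_F1_of_L2 hm f, h⟩⟩

theorem mem_graph_hodge (hm : m.LocallySummable) {f g : L2 m} :
    (f, g) ∈ (maxRealization (δ.op .hodge)).graph ↔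
      δ.toLin (L2.fn m f) + δ.boundary ⟨_, δ.mem_domain_boundary hm f⟩ = L2.fn m g :=
  mem_graph_maxRealization.trans
    ⟨fun h => h.2, fun h => ⟨⟨trivial, mem_F1_of_L2 hm f⟩, h⟩⟩

/-- Turns the pointwise equation `T f = g` into the weak one tested against all `1_τ`, the form in
which the abstract theorem takes its operators. -/
theorem eq_fn_iff {u : Fn m} {F : Simplex m → L2 m} {f g : L2 m}
    (h : ∀ τ, inner ℝ (F τ) f = τ.wt * u τ) :
    u = L2.fn m g ↔ ∀ τ, inner ℝ (F τ) f = inner ℝ (charL2 τ) g := by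
  rw [funext_iff]
  refine forall_congr' fun τ => ?_
  rw [h, inner_charL2, mul_right_inj' (Simplex.wt_pos τ).ne']

theorem laplacian_eq_and_opSpectrum_eq (hm : m.LocallySummable)
    (hQ : δ.formD .hodge = δ.formN .hodge) :
    (∀ k, δ.formD k = δ.formN k) ∧
    opSpectrum (δ.laplacianN .up) \ {0} = opSpectrum (δ.laplacianN .hodge) \ {0} ∧
    opSpectrum (δ.laplacianN .hodge) \ {0} = opSpectrum (δ.laplacianN .down) \ {0} := by
  have hQ' := hQ
  unfold formD at hQ'
  rw [← span_charL2] at hQ'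
  obtain ⟨h1, h2, h3⟩ := closureRestrict_eq_and_opSpectrum_eq
    (d := maxRealization (δ.op .up)) (e := maxRealization (δ.op .down))
    (t := maxRealization (δ.op .hodge)) (E := charL2) (B := δ.boundaryL2)
    (C := δ.coboundaryL2 hm) dense_span_charL2
    (fun f g => δ.mem_graph_up.trans (eq_fn_iff fun τ => δ.inner_boundaryL2 τ f))
    (fun f g => (δ.mem_graph_down hm).trans (eq_fn_iff fun τ => δ.inner_coboundaryL2 hm τ f))
    (fun f g => (δ.mem_graph_hodge hm).trans (eq_fn_iff fun τ => by
      rw [inner_add_left, δ.inner_boundaryL2, δ.inner_coboundaryL2, Pi.add_apply, mul_add]))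
    (fun τ => δ.mem_graph_up.2 (by rw [fn_charL2, coboundaryL2, L2.fn_toLp]))
    (fun τ => (δ.mem_graph_down hm).2 (δ.boundary_char hm τ))
    (fun f g h => δ.mem_graph_up.2 (by rw [← δ.mem_graph_up.1 h, δ.sq_zero, map_zero]))
    hQ'
  rw [span_charL2] at h1 h2
  refine ⟨fun k => ?_, h3⟩
  cases k
  · exact h1
  · exact h2
  · exact hQ

end Coboundary

end Complex

end SimplicialLaplacian

end

theorem mainTheorem4 {V : Type*} [Countable V] (K : SimplicialLaplacian.SComplex V)
    (m : SimplicialLaplacian.Weight K) (hm : m.LocallySummable)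
    (δ : SimplicialLaplacian.Coboundary m)
    (hQ : δ.formD SimplicialLaplacian.Kind.hodge = δ.formN SimplicialLaplacian.Kind.hodge) :
    (∀ k : SimplicialLaplacian.Kind, δ.laplacianD k = δ.laplacianN k) ∧
    SimplicialLaplacian.opSpectrum (δ.laplacianN SimplicialLaplacian.Kind.up) \ {0} =
      SimplicialLaplacian.opSpectrum (δ.laplacianN SimplicialLaplacian.Kind.hodge) \ {0} ∧
    SimplicialLaplacian.opSpectrum (δ.laplacianN SimplicialLaplacian.Kind.hodge) \ {0} =
      SimplicialLaplacian.opSpectrum (δ.laplacianN SimplicialLaplacian.Kind.down) \ {0} := by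
  obtain ⟨h1, h2⟩ := δ.laplacian_eq_and_opSpectrum_eq hm hQ
  exact ⟨fun k => congrArg SimplicialLaplacian.QForm.operator (h1 k), h2⟩
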